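/- The Game of Cycles is played on a finite simple connected planar graph. Two players, starting with Player 1, alternately choose an edge that carries no arrow yet and direct it (draw an arrow on it). No move may create a sink or a source, i.e. a vertex all of whose incident edges are directed towards it, respectively away from it; a player who has a legal move must move. A player wins by being the first to complete a cycle cell, i.e. a cycle cell of the board all of whose edges are directed the same way around; if no cycle cell is completed, the player who makes the last legal move wins. The cycle cells of the board are its chordless cycles. Let $G$ be a graph consisting of $p\ge 2$ paths between two distinct vertices $u$ and $v$, any two of which have no edge and no vertex other than $u,v$ in common. Suppose that the total number of edges of $G$ is odd, and that every path of odd length has at least $5$ edges, except that there may be a single path of length $3$ or a single path of length $1$ (at most one exceptional path in all). Then Player 1 has a winning strategy. Moreover, if there is an exceptional path, then for either direction of the central edge of that path (its only edge, if its length is $1$) Player 1 has a winning strategy whose first move is to direct this edge in that direction. The same holds if, instead of the chordless cycles, the cycle cells are taken to be the boundaries of the bounded faces of a planar drawing of $G$, whatever the drawing is: when the paths are drawn in any order from top to bottom, these are the cycles formed by two consecutive paths. -/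

import Mathlib

namespace GameOfCycles

variable {V : Type*}

/- The Game of Cycles on a simple graph `G`.  An arrow drawn on the edge `ab` pointing from `a` to
`b` is the dart `(a, b)` of `G`, and a position of the game is the set of arrows drawn so far. -/

/-- Every edge at the vertex `x` carries an arrow pointing to `x`
(and there is at least one such edge). -/
def IsSink (G : SimpleGraph V) (A : Set G.Dart) (x : V) : Prop :=
  (∃ y, G.Adj x y) ∧ ∀ d : G.Dart, d.snd = x → d ∈ A

/-- Every edge at the vertex `x` carries an arrow pointing away from `x`
(and there is at least one such edge). -/
def IsSource (G : SimpleGraph V) (A : Set G.Dart) (x : V) : Prop :=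
  (∃ y, G.Adj x y) ∧ ∀ d : G.Dart, d.fst = x → d ∈ A

/-- In the position `A` the arrow `d` may be drawn: its edge does not carry an arrow yet, and
drawing `d` creates neither a sink nor a source. -/
def Legal (G : SimpleGraph V) (A : Set G.Dart) (d : G.Dart) : Prop :=
  d ∉ A ∧ d.symm ∉ A ∧ ∀ x, ¬ IsSink G (insert d A) x ∧ ¬ IsSource G (insert d A) x

/-- The edge sets of the chordless cycles of `G`. -/
def chordlessCycles (G : SimpleGraph V) : Set (Set (Sym2 V)) :=
  {E | ∃ (x : V) (c : G.Walk x x), c.IsCycle ∧ c.IsChordless ∧ E = {e | e ∈ c.edges}}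

/-- In the position `A`, some cycle whose edge set is among `cells` has all its edges directed
the same way around. -/
def HasCycleCell (G : SimpleGraph V) (cells : Set (Set (Sym2 V))) (A : Set G.Dart) : Prop :=
  ∃ (x : V) (c : G.Walk x x), c.IsCycle ∧ {e | e ∈ c.edges} ∈ cells ∧ ∀ d ∈ c.darts, d ∈ A

/-- A strategy prescribes the arrow to draw in each position. -/
abbrev Strategy (G : SimpleGraph V) := Set G.Dart → G.Dart

/-- The positions with Player 1 to move that can occur, in a game that is not over yet, when
Player 1 moves first and follows `σ` while Player 2 makes arbitrary legal moves. -/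
inductive Reached (G : SimpleGraph V) (cells : Set (Set (Sym2 V))) (σ : Strategy G) :
    Set G.Dart → Prop
  | start : Reached G cells σ ∅
  | round (A : Set G.Dart) (d : G.Dart) :
      Reached G cells σ A →
      Legal G A (σ A) → ¬ HasCycleCell G cells (insert (σ A) A) →
      Legal G (insert (σ A) A) d → ¬ HasCycleCell G cells (insert d (insert (σ A) A)) →
      Reached G cells σ (insert d (insert (σ A) A))

/-- The strategy `σ` wins the game for Player 1: whatever Player 2 does, as long as the game is
not over Player 1 has the legal move prescribed by `σ`, and after it either a cycle cell has been
completed (by Player 1) or no legal move of Player 2 completes one.  On a finite board each game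
ends, so it ends with Player 1 completing the first cycle cell or making the last move. -/
def IsWinningForPlayer1 (G : SimpleGraph V) (cells : Set (Set (Sym2 V))) (σ : Strategy G) : Prop :=
  ∀ A, Reached G cells σ A → Legal G A (σ A) ∧
    (HasCycleCell G cells (insert (σ A) A) ∨
      ∀ d, Legal G (insert (σ A) A) d → ¬ HasCycleCell G cells (insert d (insert (σ A) A)))

/-- The graph `G` consists of the paths `P i` between two distinct vertices `u` and `v`, and these
paths are disjoint: two of them share no edge and no vertex besides `u` and `v`. -/
structure IsPathsBoard (G : SimpleGraph V) (u v : V) {p : ℕ} (P : Fin p → G.Walk u v) : Prop where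
  ne : u ≠ v
  isPath : ∀ i, (P i).IsPath
  vertex_disjoint : ∀ i j, i ≠ j → ∀ x, x ∈ (P i).support → x ∈ (P j).support → x = u ∨ x = v
  edge_disjoint : ∀ i j, i ≠ j → ∀ e, e ∈ (P i).edges → e ∉ (P j).edges
  vertex_cover : ∀ x, ∃ i, x ∈ (P i).support
  edge_cover : ∀ e ∈ G.edgeSet, ∃ i, e ∈ (P i).edges

/-- The boundaries of the bounded faces, when the paths are drawn in the plane between `u` and `v`
in the order `P (τ 0), P (τ 1), …` from top to bottom: a bounded face lies between each two
consecutive paths. -/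
def boundedFaces {G : SimpleGraph V} {u v : V} {p : ℕ} (P : Fin p → G.Walk u v)
    (τ : Equiv.Perm (Fin p)) : Set (Set (Sym2 V)) :=
  {E | ∃ k l : Fin p, (k : ℕ) + 1 = l ∧
    E = {e | e ∈ (P (τ k)).edges ∨ e ∈ (P (τ l)).edges}}

/-- The central edge of a walk of odd length (the only edge, if the length is `1`). -/
def centralEdge {G : SimpleGraph V} {u v : V} (w : G.Walk u v) : Sym2 V :=
  s(w.getVert (w.length / 2), w.getVert (w.length / 2 + 1))

end GameOfCycles

namespace GameOfCycles

/-! ### Positions on a single path -/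

/-! Player 1 keeps the number of open edges even after each own move and works with reflections of
the single paths: mirror edges of a path are to have the same direction along the path. Player 1
opens in the centre of an odd path, the exceptional one if it exists, and then answers a non-central
move by its mirror image as long as possible, so that every path stays `Balanced`. As no balanced
path has exactly one open edge, and a directed cycle runs along whole paths, Player 2 can never
complete a cell.

Some moves need another answer. If Player 2 plays a centre, parity provides a path with an odd
number of open edges; its centre is open and can be filled (`Balanced.exists_center`). If a path has
three open edges, mirroring would leave just one; but after Player 2's non-central move the path has
become `IsTwoLeft`, and Player 1 again plays the centre of another path. If Player 2 later fills one
of the two edges left, Player 1 fills the other.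

Finally, the answer on the same path may be illegal at `u` or `v`. Then all other paths have arrows
in one common direction at that end, and by balance near both ends: the position is `Streaming`. As
every path contains an arrow in that direction, no directed cycle can ever arise, and only the last
move matters. `Streaming.exists_move` shows that a streaming position without legal moves has an
even number of open edges, so Player 1 always has an answer. -/

/-- The number of edges without an arrow on a path with `n` edges; `w k` is the arrow on the edge
number `k`, where `some true` stands for the direction from the first to the last vertex. -/
def openCount (n : ℕ) (w : ℕ → Option Bool) : ℕ :=
  ((Finset.range n).filter (fun k => w k = none)).card

/-- No inner vertex of the path is a sink or a source. -/
def Compatible (n : ℕ) (w : ℕ → Option Bool) : Prop :=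
  ∀ k b, k + 1 < n → w k = some b → w (k + 1) ≠ some (!b)

/-- The arrows are symmetric with respect to reflecting the path and reversing all arrows. -/
def IsMirror (n : ℕ) (w : ℕ → Option Bool) : Prop :=
  ∀ k, k < n → w (n - 1 - k) = w k

/-- Precisely the central edge and one more edge are open, and all arrows agree. -/
def IsTwoLeft (n : ℕ) (w : ℕ → Option Bool) : Prop :=
  5 ≤ n ∧ Odd n ∧ ∃ k b, k < n ∧ k ≠ n / 2 ∧ w k = none ∧ w (n / 2) = none ∧
    ∀ l, l < n → l ≠ k → l ≠ n / 2 → w l = some b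

/-- The positions on a path that Player 1 aims at. -/
def Balanced (n : ℕ) (w : ℕ → Option Bool) : Prop :=
  (IsMirror n w ∧ openCount n w ≠ 1 ∧ (Odd n → n < 5 → w (n / 2) ≠ none)) ∨ IsTwoLeft n w

variable {n : ℕ} {w : ℕ → Option Bool}

/-! ### Counting open edges under reflection. -/

lemma openCount_update {k : ℕ} {b : Bool} (hk : k < n) (hw : w k = none) :
    openCount n (Function.update w k (some b)) + 1 = openCount n w := by
  have : (Finset.range n).filter (fun l => Function.update w k (some b) l = none) =
      ((Finset.range n).filter (fun l => w l = none)).erase k := by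
    ext l
    by_cases hl : l = k <;> simp [hl, Function.update_apply]
  rw [openCount, this, openCount]
  exact Finset.card_erase_add_one (by simp [hk, hw])

lemma openCount_eq_zero_of_full (h : ∀ k, k < n → w k ≠ none) : openCount n w = 0 := by
  rw [openCount, Finset.card_eq_zero, Finset.filter_eq_empty_iff]
  intro k hk
  exact h k (by simpa using hk)

/-- Reflection pairs off the open edges; its only possible fixed point is the central edge. -/
lemma IsMirror.even_openCount (hm : IsMirror n w) (hc : Odd n → w (n / 2) ≠ none) :
    Even (openCount n w) := by
  rw [← ZMod.natCast_eq_zero_iff_even, openCount, Finset.card_eq_sum_ones, Nat.cast_sum]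
  refine Finset.sum_involution (fun k _ => n - 1 - k) ?_ ?_ ?_ ?_
  · intro k _
    decide
  · intro k hk _ heq
    simp only [Finset.mem_filter, Finset.mem_range] at hk
    have hn : n = 2 * k + 1 := by omega
    refine hc ⟨k, hn⟩ ?_
    rw [show n / 2 = k by omega]
    exact hk.2
  · intro k hk
    simp only [Finset.mem_filter, Finset.mem_range] at hk ⊢
    exact ⟨by omega, by rw [hm k hk.1]; exact hk.2⟩
  · intro k hk
    simp only [Finset.mem_filter, Finset.mem_range] at hk
    omega

lemma IsMirror.update_center {b : Bool} (hm : IsMirror n w) (hn : Odd n) :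
    IsMirror n (Function.update w (n / 2) (some b)) := by
  obtain ⟨c, rfl⟩ := hn
  rw [show (2 * c + 1) / 2 = c by omega]
  intro k hk
  have := hm k hk
  rcases eq_or_ne k c with rfl | h
  · rw [show 2 * k + 1 - 1 - k = k by omega]
  · rw [Function.update_of_ne h, Function.update_of_ne (by omega), this]

lemma IsMirror.update_pair {k : ℕ} {b : Bool} (hm : IsMirror n w) (hk : k < n) :
    IsMirror n (Function.update (Function.update w k (some b)) (n - 1 - k) (some b)) := by
  intro l hl
  have := hm l hl
  simp only [Function.update_apply]
  grind

lemma IsTwoLeft.openCount_eq (h : IsTwoLeft n w) : openCount n w = 2 := by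
  obtain ⟨h5, -, k, b, hk, hkc, hwk, hwc, hall⟩ := h
  have h1 := openCount_update (b := b) hk hwk
  have h2 := openCount_update (n := n) (w := Function.update w k (some b)) (b := b)
    (k := n / 2) (by omega) (by rw [Function.update_of_ne hkc.symm]; exact hwc)
  have h3 : openCount n (Function.update (Function.update w k (some b)) (n / 2) (some b)) = 0 := by
    apply openCount_eq_zero_of_full
    intro l hl
    simp only [Function.update_apply]
    split_ifs with h1 h2
    · simp
    · simp
    · simp [hall l hl h2 h1]
  omega

lemma Balanced.openCount_ne_one (h : Balanced n w) : openCount n w ≠ 1 := by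
  rcases h with h | h
  · exact h.2.1
  · rw [h.openCount_eq]
    decide

/-- A path all of whose arrows agree with an arrow at one end has, near the other end, an arrow
in the same direction. -/
lemma Balanced.near_ends {b : Bool} (h : Balanced n w) (hn : 0 < n)
    (hb : w 0 = some b ∨ w (n - 1) = some b) :
    (w 0 = some b ∨ (1 < n ∧ w 1 = some b)) ∧
      (w (n - 1) = some b ∨ (1 < n ∧ w (n - 2) = some b)) := by
  rcases h with ⟨hm, -⟩ | ⟨h5, -, k, b', hk, hkc, hwk, hwc, hall⟩
  · have := hm 0 hn
    simp only [Nat.sub_zero] at this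
    rw [this] at hb ⊢
    simp_all
  -- As `5 ≤ n`, the centre is not among the last two edges at either end, so each of these pairs
  -- has at most one open edge.
  · have hbb : b' = b := by
      rcases hb with hb | hb
      · have := hall 0 (by omega) (by rintro rfl; simp_all) (by omega)
        simp_all
      · have := hall (n - 1) (by omega) (by rintro rfl; simp_all) (by omega)
        simp_all
    subst hbb
    constructor
    · by_cases h0 : k = 0
      · exact Or.inr ⟨by omega, hall 1 (by omega) (by omega) (by omega)⟩
      · exact Or.inl (hall 0 (by omega) (by omega) (by omega))
    · by_cases h0 : k = n - 1
      · exact Or.inr ⟨by omega, hall (n - 2) (by omega) (by omega) (by omega)⟩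
      · exact Or.inl (hall (n - 1) (by omega) (by omega) (by omega))

/-! ### Replies on one balanced path. -/

/-- The reply of Player 1 in the centre of a path with an odd number of open edges. -/
lemma Balanced.exists_center (h : Balanced n w) (hc : Compatible n w)
    (hodd : Odd (openCount n w)) :
    0 < n / 2 ∧ n / 2 < n - 1 ∧ w (n / 2) = none ∧
      ∃ b, Compatible n (Function.update w (n / 2) (some b)) ∧
        Balanced n (Function.update w (n / 2) (some b)) := by
  rcases h with ⟨hm, h1, hs⟩ | h
  · have hn : Odd n ∧ w (n / 2) = none := by
      by_contra hcon
      rw [not_and] at hcon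
      exact (Nat.not_even_iff_odd.2 hodd) (hm.even_openCount hcon)
    obtain ⟨hn, hwc⟩ := hn
    have h5 : 5 ≤ n := by
      by_contra hlt
      exact hs hn (by omega) hwc
    -- The neighbours of the centre are mirror images, so they never disagree and their direction
    -- can be copied; the default `true` serves when both are open.
    refine ⟨by omega, by omega, hwc, (w (n / 2 - 1)).getD true, ?_, Or.inl ⟨?_, ?_, ?_⟩⟩
    · have h2 := hm (n / 2 - 1) (by omega)
      obtain ⟨c, rfl⟩ := hn
      rw [show (2 * c + 1) / 2 = c by omega] at *
      rw [show 2 * c + 1 - 1 - (c - 1) = c + 1 by omega] at h2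
      intro k b hk
      have := hc k b hk
      simp only [Function.update_apply]
      rcases eq_or_ne k c with rfl | hkc
      · rw [if_pos rfl, if_neg (by omega), h2]
        rintro ⟨⟩
        cases w (k - 1) <;> simp
      · rw [if_neg hkc]
        split_ifs with hk1
        · obtain rfl : k = c - 1 := by omega
          intro h
          simp [h]
        · exact this
    · exact hm.update_center hn
    · have := (hm.update_center (b := (w (n / 2 - 1)).getD true) hn).even_openCount (by simp)
      rintro h
      rw [h] at this
      exact absurd this (by decide)
    · simp
  · rw [h.openCount_eq] at hodd
    exact absurd hodd (by decide)

lemma Compatible.const_of_full (hc : Compatible n w) {a m : ℕ} (hm : m < n)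
    (hfull : ∀ k, a ≤ k → k ≤ m → w k ≠ none) {k : ℕ} (hak : a ≤ k) (hkm : k ≤ m) :
    w k = w a := by
  induction k, hak using Nat.le_induction with
  | base => rfl
  | succ k hak ih =>
    have ih := ih (by omega)
    rw [← ih]
    obtain ⟨x, hx⟩ := Option.ne_none_iff_exists'.1 (hfull k hak (by omega))
    obtain ⟨y, hy⟩ := Option.ne_none_iff_exists'.1 (hfull (k + 1) (by omega) hkm)
    have := hc k x (by omega) hx
    rw [hx, hy] at *
    cases x <;> cases y <;> simp_all

/-- After a legal move on a symmetric path with three open edges, two open edges and arrows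
in a single direction remain. -/
lemma IsMirror.isTwoLeft_update {k : ℕ} {b : Bool} (hm : IsMirror n w) (h5 : 5 ≤ n) (hn : Odd n)
    (hk : k < n) (hkc : k ≠ n / 2) (hwk : w k = none) (hwc : w (n / 2) = none)
    (h3 : openCount n w = 3) (hc : Compatible n (Function.update w k (some b))) :
    IsTwoLeft n (Function.update w k (some b)) := by
  obtain ⟨c, rfl⟩ := hn
  rw [IsTwoLeft]
  rw [show (2 * c + 1) / 2 = c by omega] at *
  have hmk := hm k hk
  rw [show 2 * c + 1 - 1 - k = 2 * c - k by omega] at hmk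
  have hopen : ∀ l, l < 2 * c + 1 → w l = none → l = k ∨ l = c ∨ l = 2 * c - k := by
    intro l hl hwl
    by_contra hcon
    push Not at hcon
    have hsub : ({l, k, c, 2 * c - k} : Finset ℕ) ⊆
        (Finset.range (2 * c + 1)).filter (fun k => w k = none) := by
      intro x
      simp only [Finset.mem_insert, Finset.mem_singleton, Finset.mem_filter, Finset.mem_range]
      rintro (rfl | rfl | rfl | rfl)
      · exact ⟨hl, hwl⟩
      · exact ⟨hk, hwk⟩
      · exact ⟨by omega, hwc⟩
      · exact ⟨by omega, by rw [hmk, hwk]⟩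
    have := Finset.card_le_card hsub
    rw [openCount] at h3
    rw [h3, Finset.card_insert_of_notMem (by simp; tauto),
      Finset.card_insert_of_notMem (by simp; omega),
      Finset.card_insert_of_notMem (by simp; omega), Finset.card_singleton] at this
    omega
  -- The half containing `k` is full after the move, hence has one direction; reflection transfers
  -- it to the arrows of the other half.
  have hside : ∀ l, l < 2 * c + 1 → (l < c ↔ k < c) → l ≠ c →
      Function.update w k (some b) l = some b := by
    intro l hl hlc hne
    have hfull : ∀ l', l' < 2 * c + 1 → (l' < c ↔ k < c) → l' ≠ c →
        Function.update w k (some b) l' ≠ none := by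
      intro l' hl' hlc' hne'
      rw [Function.update_apply]
      split_ifs with h
      · simp
      · intro h'
        rcases hopen l' hl' h' with h | h | h <;> omega
    have hkk : Function.update w k (some b) k = some b := Function.update_self ..
    by_cases hkc' : k < c
    · refine Eq.trans ?_ hkk
      rw [hc.const_of_full (a := 0) (m := c - 1) (by omega)
        (fun l' _ _ => hfull l' (by omega) (by omega) (by omega)) (by omega) (by omega),
        hc.const_of_full (a := 0) (m := c - 1) (k := k) (by omega)
        (fun l' _ _ => hfull l' (by omega) (by omega) (by omega)) (by omega) (by omega)]
    · refine Eq.trans ?_ hkk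
      rw [hc.const_of_full (a := c + 1) (m := 2 * c) (by omega)
        (fun l' _ _ => hfull l' (by omega) (by omega) (by omega)) (by omega) (by omega),
        hc.const_of_full (a := c + 1) (m := 2 * c) (k := k) (by omega)
        (fun l' _ _ => hfull l' (by omega) (by omega) (by omega)) (by omega) (by omega)]
  refine ⟨h5, ⟨c, rfl⟩, 2 * c - k, b, by omega, by omega, ?_, ?_, ?_⟩
  · rw [Function.update_of_ne (by omega), hmk, hwk]
  · rw [Function.update_of_ne (by omega), hwc]
  · intro l hl hlk hlc
    by_cases hs : l < c ↔ k < c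
    · exact hside l hl hs hlc
    · have := hside (2 * c - l) (by omega) (by omega) (by omega)
      rw [Function.update_of_ne (by omega)] at this ⊢
      rw [← hm l hl, ← this]
      congr 1

/-- Each open edge has a neighbouring arrow, which forces Player 2's direction; Player 1 fills the
last edge alike and the path becomes constant, hence symmetric. -/
lemma IsTwoLeft.exists_reply {k : ℕ} {b : Bool} (h : IsTwoLeft n w) (hk : k < n)
    (hwk : w k = none) (hc : Compatible n (Function.update w k (some b))) :
    ∃ k', k' < n ∧ Function.update w k (some b) k' = none ∧
      Compatible n (Function.update (Function.update w k (some b)) k' (some b)) ∧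
      Balanced n (Function.update (Function.update w k (some b)) k' (some b)) := by
  obtain ⟨h5, hn, k₀, b₀, hk₀, hkc, hwk₀, hwc, hall⟩ := h
  obtain ⟨c, rfl⟩ := hn
  rw [show (2 * c + 1) / 2 = c by omega] at *
  have hk' : k = k₀ ∨ k = c := by
    by_contra hcon
    push Not at hcon
    rw [hall k hk hcon.1 hcon.2] at hwk
    cases hwk
  have hb : b₀ = b := by
    by_contra hne
    have hne : b₀ = !b := by cases b <;> cases b₀ <;> simp_all
    -- The edge before `k` serves unless it is missing or open; in that case the edge after `k`
    -- exists and carries an arrow, because `c ≥ 2`.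
    have hl : ∃ l, l < 2 * c + 1 ∧ l ≠ k₀ ∧ l ≠ c ∧ (l = k + 1 ∨ l + 1 = k) := by
      by_cases hlt : k = 0 ∨ k - 1 = k₀ ∨ k - 1 = c
      · exact ⟨k + 1, by omega, by omega, by omega, by omega⟩
      · exact ⟨k - 1, by omega, by omega, by omega, by omega⟩
    obtain ⟨l, hl, hlk, hlc, rfl | rfl⟩ := hl
    · refine hc k b hl (by simp) ?_
      rw [Function.update_of_ne (by omega), hall _ hl hlk hlc, hne]
    · refine hc l (!b) hk ?_ (by simp)
      rw [Function.update_of_ne (by omega), hall _ hl hlk hlc, hne]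
  subst hb
  obtain ⟨k', hk'', hset⟩ : ∃ k', k' ≠ k ∧ ∀ l, (l = k₀ ∨ l = c) ↔ (l = k ∨ l = k') := by
    rcases hk' with rfl | rfl
    · exact ⟨c, by omega, by omega⟩
    · exact ⟨k₀, by omega, by omega⟩
  have hfull : ∀ l, l < 2 * c + 1 →
      Function.update (Function.update w k (some b₀)) k' (some b₀) l = some b₀ := by
    intro l hl
    have := hset l
    simp only [Function.update_apply]
    split_ifs with h1 h2
    · rfl
    · rfl
    · exact hall l hl (by tauto) (by tauto)
  have hk'w : k' < 2 * c + 1 ∧ w k' = none := by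
    rcases (hset k').2 (Or.inr rfl) with rfl | rfl
    · exact ⟨hk₀, hwk₀⟩
    · exact ⟨by omega, hwc⟩
  refine ⟨k', hk'w.1, ?_, ?_, Or.inl ⟨?_, ?_, ?_⟩⟩
  · rw [Function.update_of_ne hk'', hk'w.2]
  · intro l b hl h1
    rw [hfull l (by omega)] at h1
    rw [hfull _ hl, h1]
    simp
  · intro l hl
    rw [hfull l hl, hfull _ (by omega)]
  · rw [openCount_eq_zero_of_full (fun l hl => by simp [hfull l hl])]
    decide
  · intro _ _
    simp [hfull ((2 * c + 1) / 2) (by omega)]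

/-- A conflict at the mirror edge reflects to a conflict at `k`; if the two edges are adjacent, they
agree anyway. -/
lemma IsMirror.compatible_update_pair {k : ℕ} {b : Bool} (hm : IsMirror n w) (hk : k < n)
    (hkc : Odd n → k ≠ n / 2)
    (hc : Compatible n (Function.update w k (some b))) :
    Compatible n
      (Function.update (Function.update w k (some b)) (n - 1 - k) (some b)) := by
  have hne : k ≠ n - 1 - k := by
    intro h
    exact hkc ⟨k, by omega⟩ (by omega)
  have hm' := hm.update_pair (b := b) hk
  intro l x hl h1 h2
  by_cases hA : l = n - 1 - k ∨ l + 1 = n - 1 - k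
  · by_cases hB : l = k ∨ l + 1 = k
    · have : x = b ∧ (!x) = b := by
        rcases hA with hA | hA <;> rcases hB with hB | hB
        · omega
        · rw [hA, Function.update_self] at h1
          rw [hB, Function.update_of_ne hne, Function.update_self] at h2
          simp_all
        · rw [hA, Function.update_self] at h2
          rw [hB, Function.update_of_ne hne, Function.update_self] at h1
          simp_all
        · omega
      cases x <;> simp_all
    · have e1 := hm' l (by omega)
      have e2 := hm' (l + 1) hl
      rw [h1] at e1
      rw [h2] at e2
      rw [Function.update_of_ne (by omega)] at e1 e2
      refine hc (n - 1 - (l + 1)) (!x) (by omega) e2 ?_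
      rw [show n - 1 - (l + 1) + 1 = n - 1 - l by omega, e1]
      simp
  · push Not at hA
    rw [Function.update_of_ne hA.1] at h1
    rw [Function.update_of_ne hA.2] at h2
    exact hc l x hl h1 h2

/-- After a legal move on a balanced path, either the path is balanced with an even number of
open edges, or Player 1 has a reply on the path that makes it balanced. -/
lemma Balanced.reply {k : ℕ} {b : Bool} (h : Balanced n w) (hk : k < n) (hwk : w k = none)
    (hc : Compatible n (Function.update w k (some b))) :
    (Balanced n (Function.update w k (some b)) ∧
        Even (openCount n (Function.update w k (some b)))) ∨
      ∃ k', k' < n ∧ Function.update w k (some b) k' = none ∧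
        Compatible n (Function.update (Function.update w k (some b)) k' (some b)) ∧
        Balanced n (Function.update (Function.update w k (some b)) k' (some b)) := by
  rcases h with ⟨hm, h1, hs⟩ | h
  · by_cases hkc : Odd n ∧ k = n / 2
    · obtain ⟨hn, rfl⟩ := hkc
      have he := (hm.update_center (b := b) hn).even_openCount (by simp)
      refine Or.inl ⟨Or.inl ⟨hm.update_center hn, ?_, by simp⟩, he⟩
      intro h
      rw [h] at he
      exact absurd he (by decide)
    · rw [not_and] at hkc
      by_cases h3 : openCount n w = 3
      · have hn : Odd n ∧ w (n / 2) = none := by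
          by_contra hcon
          rw [not_and] at hcon
          have := hm.even_openCount hcon
          rw [h3] at this
          exact absurd this (by decide)
        have h5 : 5 ≤ n := by
          by_contra hlt
          exact hs hn.1 (by omega) hn.2
        have := hm.isTwoLeft_update h5 hn.1 hk (hkc hn.1) hwk hn.2 h3 hc
        exact Or.inl ⟨Or.inr this, by rw [this.openCount_eq]; decide⟩
      · have hne : n - 1 - k ≠ k := by
          intro h
          exact hkc ⟨k, by omega⟩ (by omega)
        have hk' : Function.update w k (some b) (n - 1 - k) = none := by
          rw [Function.update_of_ne hne, hm k hk, hwk]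
        refine Or.inr ⟨n - 1 - k, by omega, hk', hm.compatible_update_pair hk hkc hc,
          Or.inl ⟨hm.update_pair hk, ?_, ?_⟩⟩
        · have e1 := openCount_update (b := b) hk hwk
          have e2 := openCount_update (n := n) (b := b) (by omega) hk'
          omega
        · intro hn h5
          have := hs hn h5
          simp only [Function.update_apply]
          split_ifs <;> simp [this]
  · exact Or.inr (h.exists_reply hk hwk hc)

/-! ### Parity on a path without legal moves. -/

/-- The parity of the number of open edges on a path without legal moves. -/
lemma odd_openCount_iff {b : Bool} (hn : 0 < n) (hc : Compatible n w)
    (hstart : w 0 = none → 1 < n ∧ w 1 = some b)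
    (hfinish : w (n - 1) = none → 1 < n ∧ w (n - 2) = some b)
    (hblocked : ∀ k, k + 2 < n → w (k + 1) = none → ∃ x, w k = some x ∧ w (k + 2) = some (!x)) :
    Odd (openCount n w) ↔ ¬(w 0 = some b ↔ w (n - 1) = some b) := by
  -- `r k` is the direction in force just after an open edge `k`, or on it if it has an arrow.
  -- Blocked edges are exactly where it flips, so parity compares its values at the ends. An open
  -- end edge counts as direction `!b` outside the path, whence the value `!b` at an open last edge.
  let r : ℕ → Bool := fun k =>
    match w k with
    | some x => x
    | none => if k + 1 < n then (w (k + 1)).getD b else !b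
  have hr : ∀ k x, w k = some x → r k = x := by
    intro k x h
    simp [r, h]
  have hr' : ∀ k, k + 1 < n → w k = none → r k = (w (k + 1)).getD b := by
    intro k hk h
    simp [r, h, hk]
  have key : ∀ m, m < n → (Odd (openCount (m + 1) w) ↔ ¬(w 0 = some b ↔ r m = b)) := by
    intro m
    induction m with
    | zero =>
      intro _
      rcases h0 : w 0 with _ | x
      · obtain ⟨h1, h2⟩ := hstart h0
        have : openCount 1 w = 1 := by simp [openCount, Finset.filter_singleton, h0]
        rw [hr' 0 h1 h0]
        simp [this, h2]
      · have : openCount 1 w = 0 := by simp [openCount, Finset.filter_singleton, h0]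
        simp [this, hr 0 x h0]
    | succ m ih =>
      intro hm
      have ih := ih (by omega)
      rcases hw : w (m + 1) with _ | x
      · have hcount : openCount (m + 2) w = openCount (m + 1) w + 1 := by
          simp [openCount, Finset.range_add_one (n := m + 1), Finset.filter_insert, hw]
        have hflip : r (m + 1) = !r m := by
          by_cases hlast : m + 2 < n
          · obtain ⟨y, hy, hy'⟩ := hblocked m hlast hw
            rw [hr' (m + 1) hlast hw, hr m y hy, hy']
            rfl
          · have hn' : n = m + 2 := by omega
            have := hfinish (by rw [hn']; exact hw)
            rw [hn', Nat.add_sub_cancel] at this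
            rw [hr m b this.2]
            simp [r, hw, hlast]
        rw [hcount, Nat.odd_add_one, ih, hflip]
        cases r m <;> cases b <;> simp
      · have hcount : openCount (m + 2) w = openCount (m + 1) w := by
          simp [openCount, Finset.range_add_one (n := m + 1), Finset.filter_insert, hw]
        have hsame : r (m + 1) = r m := by
          rw [hr _ _ hw]
          rcases hw' : w m with _ | y
          · rw [hr' m hm hw', hw]
            rfl
          · rw [hr _ _ hw']
            have := hc m y hm hw'
            rw [hw] at this
            cases x <;> cases y <;> simp_all
        rw [hcount, ih, hsame]
  have := key (n - 1) (by omega)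
  rw [show n - 1 + 1 = n by omega] at this
  rw [this]
  have hlast : r (n - 1) = b ↔ w (n - 1) = some b := by
    rcases hw : w (n - 1) with _ | x
    · simp [r, hw, show ¬ (n - 1 + 1 < n) by omega]
    · simp [hr _ _ hw]
  rw [hlast]

/-! ### Positions on several paths with common ends -/

section Model

variable {ι : Type*}

/-- None of the vertices is a sink or a source. -/
structure Admissible (n : ι → ℕ) (s : ι → ℕ → Option Bool) : Prop where
  compatible : ∀ i, Compatible (n i) (s i)
  start : ∀ b, ∃ i, s i 0 ≠ some b
  finish : ∀ b, ∃ i, s i (n i - 1) ≠ some b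

/-- Each path has an arrow in the direction `b`, and, with at most one exception at each of the
two ends, one of the last two edges of each path is directed that way. -/
structure Streaming (n : ι → ℕ) (b : Bool) (s : ι → ℕ → Option Bool) : Prop where
  exists_arrow : ∀ i, ∃ k, k < n i ∧ s i k = some b
  start : ∃ e, ∀ i, i ≠ e → s i 0 = some b ∨ (1 < n i ∧ s i 1 = some b)
  finish : ∃ e, ∀ i, i ≠ e → s i (n i - 1) = some b ∨ (1 < n i ∧ s i (n i - 2) = some b)

variable [DecidableEq ι]

/-- The position after drawing an arrow on the edge number `k` of the path `i`. -/
def draw (s : ι → ℕ → Option Bool) (i : ι) (k : ℕ) (b : Bool) : ι → ℕ → Option Bool :=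
  Function.update s i (Function.update (s i) k (some b))

/-- The positions that Player 1 aims at. -/
structure Controlled [Fintype ι] (n : ι → ℕ) (s : ι → ℕ → Option Bool) : Prop where
  even : Even (∑ i, openCount (n i) (s i))
  admissible : Admissible n s
  shape : (∀ i, Balanced (n i) (s i)) ∨ ∃ b, Streaming n b s

variable {n : ι → ℕ} {s : ι → ℕ → Option Bool}

lemma draw_same (i : ι) (k : ℕ) (b : Bool) :
    draw s i k b i = Function.update (s i) k (some b) := by
  simp [draw]

lemma draw_of_ne {i j : ι} (k : ℕ) (b : Bool) (h : j ≠ i) : draw s i k b j = s j := by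
  simp [draw, h]

lemma le_draw {i j : ι} {k l : ℕ} {b x : Bool} (hk : s i k = none) (h : s j l = some x) :
    draw s i k b j l = some x := by
  by_cases hj : j = i
  · subst hj
    rw [draw_same, Function.update_of_ne, h]
    rintro rfl
    simp_all
  · rw [draw_of_ne _ _ hj, h]

/-- Streaming only asks for arrows to be present, and arrows are never removed. -/
lemma Streaming.draw {i : ι} {k : ℕ} {b x : Bool} (h : Streaming n b s) (hk : s i k = none) :
    Streaming n b (draw s i k x) where
  exists_arrow j := by
    obtain ⟨l, hl, hs⟩ := h.exists_arrow j
    exact ⟨l, hl, le_draw hk hs⟩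
  start := by
    obtain ⟨e, he⟩ := h.start
    exact ⟨e, fun j hj => (he j hj).imp (le_draw hk) (And.imp_right (le_draw hk))⟩
  finish := by
    obtain ⟨e, he⟩ := h.finish
    exact ⟨e, fun j hj => (he j hj).imp (le_draw hk) (And.imp_right (le_draw hk))⟩

lemma sum_openCount_draw [Fintype ι] {i : ι} {k : ℕ} {b : Bool} (hk : k < n i)
    (hs : s i k = none) :
    ∑ j, openCount (n j) (draw s i k b j) + 1 = ∑ j, openCount (n j) (s j) := by
  rw [← Finset.add_sum_erase _ _ (Finset.mem_univ i), ← Finset.add_sum_erase (a := i) _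
    (fun j => openCount (n j) (s j)) (Finset.mem_univ i), draw_same, ← openCount_update hk hs,
    Finset.sum_congr rfl (g := fun j => openCount (n j) (s j))]
  · ring
  · intro j hj
    rw [draw_of_ne _ _ (Finset.ne_of_mem_erase hj)]

/-- A move that respects the inner vertices of its path is legal unless it makes one of the common
ends a sink or a source. -/
lemma Admissible.draw_or {i : ι} {k : ℕ} {b : Bool} (h : Admissible n s)
    (hc : Compatible (n i) (Function.update (s i) k (some b))) :
    Admissible n (draw s i k b) ∨ (k = 0 ∧ ∀ j, j ≠ i → s j 0 = some b) ∨
      (k = n i - 1 ∧ ∀ j, j ≠ i → s j (n j - 1) = some b) := by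
  by_contra hcon
  push Not at hcon
  obtain ⟨h1, h2, h3⟩ := hcon
  refine h1 ⟨?_, ?_, ?_⟩
  · intro j
    by_cases hj : j = i
    · subst hj
      rwa [draw_same]
    · rw [draw_of_ne _ _ hj]
      exact h.compatible j
  · intro x
    by_contra hall
    push Not at hall
    have hx : k = 0 ∧ x = b := by
      obtain ⟨j, hj⟩ := h.start x
      have hj' := hall j
      by_cases hji : j = i
      · subst hji
        rw [draw_same, Function.update_apply] at hj'
        split_ifs at hj' with h0
        · exact ⟨h0.symm, by simpa using hj'.symm⟩
        · exact absurd hj' hj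
      · rw [draw_of_ne _ _ hji] at hj'
        exact absurd hj' hj
    obtain ⟨j, hj, hjb⟩ := h2 hx.1
    refine hjb ?_
    rw [← hx.2, ← hall j, draw_of_ne _ _ hj]
  · intro x
    by_contra hall
    push Not at hall
    have hx : k = n i - 1 ∧ x = b := by
      obtain ⟨j, hj⟩ := h.finish x
      have hj' := hall j
      by_cases hji : j = i
      · subst hji
        rw [draw_same, Function.update_apply] at hj'
        split_ifs at hj' with h0
        · exact ⟨h0.symm, by simpa using hj'.symm⟩
        · exact absurd hj' hj
      · rw [draw_of_ne _ _ hji] at hj'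
        exact absurd hj' hj
    obtain ⟨j, hj, hjb⟩ := h3 hx.1
    refine hjb ?_
    rw [← hx.2, ← hall j, draw_of_ne _ _ hj]

/-- An inner edge without a legal move lies between two opposite arrows. -/
lemma Admissible.blocked_inner {i : ι} {k : ℕ} (h : Admissible n s) (hk : k + 2 < n i)
    (hs : s i (k + 1) = none) (hno : ∀ b, ¬ Admissible n (draw s i (k + 1) b)) :
    ∃ x, s i k = some x ∧ s i (k + 2) = some (!x) := by
  have hmove : ∀ b, s i k = some (!b) ∨ s i (k + 2) = some (!b) := by
    intro b
    by_contra hcon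
    push Not at hcon
    have hc : Compatible (n i) (Function.update (s i) (k + 1) (some b)) := by
      intro l x hl
      simp only [Function.update_apply]
      have hl' := h.compatible i l x hl
      split_ifs with h1 h2 h2
      · omega
      · rintro ⟨⟩
        obtain rfl : l = k + 1 := h1
        exact hcon.2
      · obtain rfl : l = k := by omega
        rintro h3 h4
        refine hcon.1 ?_
        rw [h3]
        simp_all
      · exact hl'
    rcases h.draw_or hc with h1 | h1 | h1
    · exact hno b h1
    · omega
    · omega
  have h1 := hmove true
  have h2 := hmove false
  rcases h1 with h1 | h1
  · exact ⟨false, h1, by simpa [h1] using h2⟩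
  · exact ⟨true, by simpa [h1] using h2, h1⟩

/-! ### Streaming positions and the last move. -/

/-- In a streaming position there is a legal move if an odd number of edges is open. -/
lemma Streaming.exists_move [Fintype ι] [Nontrivial ι] {b : Bool} (h : Streaming n b s)
    (ha : Admissible n s) (hn : ∀ i, 0 < n i) (hodd : Odd (∑ i, openCount (n i) (s i))) :
    ∃ i k x, k < n i ∧ s i k = none ∧ Admissible n (GameOfCycles.draw s i k x) := by
  by_contra hno
  push Not at hno
  have hlen : ∀ i k, k < n i → s i k = none → 1 < n i := by
    intro i k hk hs
    obtain ⟨l, hl, hl'⟩ := h.exists_arrow i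
    have : k ≠ l := by
      rintro rfl
      simp_all
    omega
  have hstart : ∀ i, s i 0 = none → (1 < n i ∧ s i 1 = some b) ∧
      ∀ j, j ≠ i → s j 0 = some b := by
    intro i hi
    have h1 := hlen i 0 (hn i) hi
    -- Drawing `x` on this end edge can only fail at the inner neighbour or at the common end.
    have hmove : ∀ x, s i 1 = some (!x) ∨ ∀ j, j ≠ i → s j 0 = some x := by
      intro x
      by_contra hcon
      rw [not_or] at hcon
      have hc : Compatible (n i) (Function.update (s i) 0 (some x)) := by
        intro l y hl
        have hl' := ha.compatible i l y hl
        simp only [Function.update_apply]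
        rw [if_neg (Nat.succ_ne_zero l)]
        split_ifs with h0
        · subst h0
          rintro ⟨⟩
          exact hcon.1
        · exact hl'
      rcases ha.draw_or hc with h2 | h2 | h2
      · exact hno i 0 x (hn i) hi h2
      · exact hcon.2 h2.2
      · omega
    obtain ⟨j, hj⟩ := exists_ne i
    rcases hmove (!b) with h2 | h2
    · rw [Bool.not_not] at h2
      exact ⟨⟨h1, h2⟩, (hmove b).resolve_left (by simp [h2])⟩
    -- Here every other path starts against `b`, so each of them is the exceptional path `e`. Then
    -- `i` is not exceptional, yet its first edge is open and its second points against `b`.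
    · exfalso
      have h3 : s i 1 = some (!b) := (hmove b).resolve_right (fun h3 => by
        simpa [h2 j hj] using h3 j hj)
      obtain ⟨e, he⟩ := h.start
      have hje : j = e := by
        by_contra hje
        rcases he j hje with h4 | ⟨h4, h5⟩
        · simp [h2 j hj] at h4
        · exact ha.compatible j 0 (!b) h4 (h2 j hj) (by simpa using h5)
      have := he i (by rintro rfl; exact hj hje)
      simp [hi, h3] at this
  have hfinish : ∀ i, s i (n i - 1) = none → (1 < n i ∧ s i (n i - 2) = some b) ∧
      ∀ j, j ≠ i → s j (n j - 1) = some b := by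
    intro i hi
    have h0 := hn i
    have h1 := hlen i (n i - 1) (by omega) hi
    have hmove : ∀ x, s i (n i - 2) = some (!x) ∨ ∀ j, j ≠ i → s j (n j - 1) = some x := by
      intro x
      by_contra hcon
      rw [not_or] at hcon
      have hc : Compatible (n i) (Function.update (s i) (n i - 1) (some x)) := by
        intro l y hl
        have hl' := ha.compatible i l y hl
        simp only [Function.update_apply]
        rw [if_neg (show l ≠ n i - 1 by omega)]
        split_ifs with h0
        · obtain rfl : l = n i - 2 := by omega
          rintro h3 h4
          refine hcon.1 ?_
          rw [h3]
          simp_all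
        · exact hl'
      rcases ha.draw_or hc with h2 | h2 | h2
      · exact hno i (n i - 1) x (by omega) hi h2
      · omega
      · exact hcon.2 h2.2
    obtain ⟨j, hj⟩ := exists_ne i
    rcases hmove (!b) with h2 | h2
    · rw [Bool.not_not] at h2
      exact ⟨⟨h1, h2⟩, (hmove b).resolve_left (by simp [h2])⟩
    · exfalso
      have h3 : s i (n i - 2) = some (!b) := (hmove b).resolve_right (fun h3 => by
        simpa [h2 j hj] using h3 j hj)
      obtain ⟨e, he⟩ := h.finish
      have hje : j = e := by
        by_contra hje
        rcases he j hje with h4 | ⟨h4, h5⟩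
        · simp [h2 j hj] at h4
        · refine ha.compatible j (n j - 2) b (by omega) h5 ?_
          rw [show n j - 2 + 1 = n j - 1 by omega]
          exact h2 j hj
      have := he i (by rintro rfl; exact hj hje)
      simp [hi, h3] at this
  -- Exactly one path fails to start with `b`: at least one by admissibility. If two failed, neither
  -- start could be open, so both would point against `b` and both would be the exception of
  -- `Streaming`.
  have hone : ∑ i, (if s i 0 = some b then 0 else 1) = 1 := by
    obtain ⟨i, hi⟩ := ha.start b
    rw [Finset.sum_eq_single i]
    · simp [hi]
    · intro j _ hj
      rw [if_pos]
      by_contra hjb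
      have hi' : s i 0 = some (!b) := by
        rcases hx : s i 0 with _ | x
        · exact absurd ((hstart i hx).2 j hj) hjb
        · cases x <;> cases b <;> simp_all
      have hj' : s j 0 = some (!b) := by
        rcases hx : s j 0 with _ | x
        · exact absurd ((hstart j hx).2 i hj.symm) hi
        · cases x <;> cases b <;> simp_all
      obtain ⟨e, he⟩ := h.start
      have hbad : ∀ k, s k 0 = some (!b) → k = e := by
        intro k hk
        by_contra hke
        rcases he k hke with h4 | ⟨h4, h5⟩
        · simp [hk] at h4
        · exact ha.compatible k 0 (!b) h4 hk (by simpa using h5)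
      exact hj ((hbad j hj').trans (hbad i hi').symm)
    · simp
  have hone' : ∑ i, (if s i (n i - 1) = some b then 0 else 1) = 1 := by
    obtain ⟨i, hi⟩ := ha.finish b
    rw [Finset.sum_eq_single i]
    · simp [hi]
    · intro j _ hj
      rw [if_pos]
      by_contra hjb
      have hi' : s i (n i - 1) = some (!b) := by
        rcases hx : s i (n i - 1) with _ | x
        · exact absurd ((hfinish i hx).2 j hj) hjb
        · cases x <;> cases b <;> simp_all
      have hj' : s j (n j - 1) = some (!b) := by
        rcases hx : s j (n j - 1) with _ | x
        · exact absurd ((hfinish j hx).2 i hj.symm) hi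
        · cases x <;> cases b <;> simp_all
      obtain ⟨e, he⟩ := h.finish
      have hbad : ∀ k, s k (n k - 1) = some (!b) → k = e := by
        intro k hk
        by_contra hke
        rcases he k hke with h4 | ⟨h4, h5⟩
        · simp [hk] at h4
        · refine ha.compatible k (n k - 2) b (by omega) h5 ?_
          rw [show n k - 2 + 1 = n k - 1 by omega]
          exact hk
      exact hj ((hbad j hj').trans (hbad i hi').symm)
    · simp
  -- Modulo 2, the open edges of each path count its ends without `b`; summed over all paths these
  -- are `1 + 1`, so the total is even.
  have hpar : ∀ i, Even (openCount (n i) (s i) + ((if s i 0 = some b then 0 else 1) +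
      if s i (n i - 1) = some b then 0 else 1)) := by
    intro i
    have := odd_openCount_iff (hn i) (ha.compatible i) (fun h => (hstart i h).1)
      (fun h => (hfinish i h).1) (fun k hk hs =>
        ha.blocked_inner hk hs (fun x => hno i (k + 1) x (by omega) hs))
    rw [← Nat.not_even_iff_odd] at this
    rw [Nat.even_add]
    split_ifs <;> simp_all
  have htotal : Even (∑ i, (openCount (n i) (s i) + ((if s i 0 = some b then 0 else 1) +
      if s i (n i - 1) = some b then 0 else 1))) := Finset.even_sum _ fun i _ => hpar i
  rw [Finset.sum_add_distrib, Finset.sum_add_distrib, hone, hone', Nat.even_add] at htotal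
  exact (Nat.not_even_iff_odd.2 hodd) (htotal.2 (by decide))

/-! ### The answer of Player 1 and the opening. -/

/-- Player 1 can answer each legal move in a controlled position. -/
theorem Controlled.exists_reply [Fintype ι] [Nontrivial ι] (h : Controlled n s)
    (hn : ∀ i, 0 < n i) {i : ι} {k : ℕ} {b : Bool} (hk : k < n i) (hs : s i k = none)
    (ha : Admissible n (draw s i k b)) :
    ∃ i' k' b', k' < n i' ∧ draw s i k b i' k' = none ∧
      Controlled n (draw (draw s i k b) i' k' b') := by
  have hsum := sum_openCount_draw (b := b) hk hs
  set t := draw s i k b with ht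
  have hodd : Odd (∑ j, openCount (n j) (t j)) := by
    have := h.even
    rwa [← hsum, Nat.even_add_one, Nat.not_even_iff_odd] at this
  have heven : ∀ j l x, l < n j → t j l = none →
      Even (∑ j', openCount (n j') (draw t j l x j')) := by
    intro j l x hl hjl
    rwa [← sum_openCount_draw (b := x) hl hjl, Nat.odd_add_one, Nat.not_odd_iff_even] at hodd
  have hstream : (∃ x, Streaming n x t) → ∃ i' k' b', k' < n i' ∧ t i' k' = none ∧
      Controlled n (draw t i' k' b') := by
    rintro ⟨x, hx⟩
    obtain ⟨j, l, y, hl, hjl, hadm⟩ := hx.exists_move ha hn hodd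
    exact ⟨j, l, y, hl, hjl, heven j l y hl hjl, hadm, Or.inr ⟨x, hx.draw hjl⟩⟩
  rcases h.shape with hb | ⟨x, hx⟩
  · have hcomp := ha.compatible i
    rw [ht, draw_same] at hcomp
    have htb : ∀ j, j ≠ i → Balanced (n j) (t j) := by
      intro j hj
      rw [ht, draw_of_ne _ _ hj]
      exact hb j
    rcases (hb i).reply hk hs hcomp with ⟨hbal, hev⟩ | ⟨k', hk', hs', hc', hbal⟩
    · rw [← draw_same, ← ht] at hbal hev
      have hall : ∀ j, Balanced (n j) (t j) := by
        intro j
        by_cases hj : j = i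
        · rwa [hj]
        · exact htb j hj
      -- The path just played on needs no answer, so the odd total is repaired on a path with an odd
      -- count; its centre is not an end edge, so `u` and `v` are not affected.
      obtain ⟨j, hj⟩ : ∃ j, Odd (openCount (n j) (t j)) := by
        by_contra hcon
        push Not at hcon
        exact (Nat.not_even_iff_odd.2 hodd) (Finset.even_sum _ fun j _ =>
          Nat.not_odd_iff_even.1 (hcon j))
      obtain ⟨h1, h2, h3, x, h4, h5⟩ := (hall j).exists_center (ha.compatible j) hj
      refine ⟨j, n j / 2, x, by omega, h3, heven _ _ _ (by omega) h3, ?_, Or.inl ?_⟩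
      · rcases ha.draw_or h4 with h6 | h6 | h6
        · exact h6
        · omega
        · omega
      · intro l
        by_cases hl : l = j
        · subst hl
          rwa [draw_same]
        · rw [draw_of_ne _ _ hl]
          exact hall l
    · have heq : Function.update (s i) k (some b) = t i := by rw [ht, draw_same]
      rw [heq] at hs' hc' hbal
      have harrow : t i k = some b := by
        rw [ht, draw_same, Function.update_self]
      -- If the reply is illegal at a common end, all other paths have `b` there; `i` is the
      -- exception allowed at both ends, and Player 2's own move is its arrow.
      have hjam : (∀ j, j ≠ i → t j 0 = some b ∨ t j (n j - 1) = some b) →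
          Streaming n b t := by
        intro hj
        refine ⟨?_, ⟨i, fun j hji => ((htb j hji).near_ends (hn j) (hj j hji)).1⟩,
          ⟨i, fun j hji => ((htb j hji).near_ends (hn j) (hj j hji)).2⟩⟩
        intro j
        by_cases hji : j = i
        · exact ⟨k, by rwa [hji], by rwa [hji]⟩
        · have := hn j
          rcases hj j hji with h0 | h0
          · exact ⟨0, this, h0⟩
          · exact ⟨n j - 1, by omega, h0⟩
      rcases ha.draw_or hc' with h6 | h6 | h6
      · refine ⟨i, k', b, hk', hs', heven _ _ _ hk' hs', h6, Or.inl ?_⟩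
        intro l
        by_cases hl : l = i
        · subst hl
          rwa [draw_same]
        · rw [draw_of_ne _ _ hl]
          exact htb l hl
      · exact hstream ⟨b, hjam fun j hj => Or.inl (h6.2 j hj)⟩
      · exact hstream ⟨b, hjam fun j hj => Or.inr (h6.2 j hj)⟩
  · exact hstream ⟨x, hx.draw hs⟩

/-- Player 1 may open with the central edge of a path of odd length. -/
lemma controlled_draw_center [Fintype ι] [Nontrivial ι] (hopen : ∀ i k, s i k = none)
    (hsum : Odd (∑ i, openCount (n i) (s i))) {i : ι} (hi : Odd (n i))
    (hlong : ∀ j, j ≠ i → Odd (n j) → 5 ≤ n j) (b : Bool) :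
    Controlled n (draw s i (n i / 2) b) := by
  have hi0 : 0 < n i := hi.pos
  obtain ⟨j, hj⟩ := exists_ne i
  refine ⟨?_, ⟨?_, ?_, ?_⟩, Or.inl ?_⟩
  · rwa [← sum_openCount_draw (b := b) (by omega) (hopen i (n i / 2)), Nat.odd_add_one,
      Nat.not_odd_iff_even] at hsum
  · intro l k x _ h
    by_cases hl : l = i
    · subst hl
      rw [draw_same, Function.update_apply] at h ⊢
      split_ifs at h with h1
      · rw [if_neg (by omega), hopen]
        simp
      · simp [hopen] at h
    · simp [draw_of_ne _ _ hl, hopen] at h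
  · exact fun x => ⟨j, by simp [draw_of_ne _ _ hj, hopen]⟩
  · exact fun x => ⟨j, by simp [draw_of_ne _ _ hj, hopen]⟩
  · intro l
    left
    by_cases hl : l = i
    · subst hl
      rw [draw_same]
      have hm : IsMirror (n l) (s l) := fun k _ => by rw [hopen, hopen]
      have he := (hm.update_center (b := b) hi).even_openCount (by simp)
      refine ⟨hm.update_center hi, ?_, by simp⟩
      intro h
      rw [h] at he
      exact absurd he (by decide)
    · rw [draw_of_ne _ _ hl]
      refine ⟨fun k _ => by rw [hopen, hopen], ?_, fun h1 h2 => ?_⟩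
      -- An untouched path could violate `openCount ≠ 1` only by having length 1, which is odd and
      -- below 5.
      · have : openCount (n l) (s l) = n l := by simp [openCount, hopen]
        rw [this]
        intro h1
        have := hlong l hl (by rw [h1]; decide)
        omega
      · have := hlong l hl h1
        omega

end Model

/-! ### The arrows on the paths of the board -/

section Board

variable {V : Type*} {G : SimpleGraph V} {u v : V}

/-- The arrow on the edge number `k` of a walk, directed along the walk if `b` is `true`. -/
def pathDart (w : G.Walk u v) {k : ℕ} (hk : k < w.length) (b : Bool) : G.Dart :=
  if b then ⟨(w.getVert k, w.getVert (k + 1)), w.adj_getVert_succ hk⟩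
  else ⟨(w.getVert (k + 1), w.getVert k), (w.adj_getVert_succ hk).symm⟩

/-- The head of a dart, or its tail if `c` is `false`. -/
def dartEnd (c : Bool) (d : G.Dart) : V := if c then d.snd else d.fst

/-- No edge carries two arrows. -/
def Consistent (A : Set G.Dart) : Prop := ∀ d ∈ A, d.symm ∉ A

lemma pathDart_symm (w : G.Walk u v) {k : ℕ} (hk : k < w.length) (b : Bool) :
    (pathDart w hk b).symm = pathDart w hk (!b) := by
  cases b <;> rfl

lemma dartEnd_pathDart (w : G.Walk u v) {k : ℕ} (hk : k < w.length) (b c : Bool) :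
    dartEnd c (pathDart w hk b) = w.getVert (if b = c then k + 1 else k) := by
  cases b <;> cases c <;> rfl

lemma pathDart_edge (w : G.Walk u v) {k : ℕ} (hk : k < w.length) (b : Bool) :
    (pathDart w hk b).edge = s(w.getVert k, w.getVert (k + 1)) := by
  cases b
  · exact Sym2.eq_swap
  · rfl

lemma no_sink_no_source_iff {A : Set G.Dart} {x : V} :
    (¬ IsSink G A x ∧ ¬ IsSource G A x) ↔
      ∀ c, ¬ ((∃ y, G.Adj x y) ∧ ∀ d : G.Dart, dartEnd c d = x → d ∈ A) := by
  rw [Bool.forall_bool]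
  exact and_comm

lemma mem_edges_iff_exists_getVert (w : G.Walk u v) (e : Sym2 V) :
    e ∈ w.edges ↔ ∃ k, k < w.length ∧ e = s(w.getVert k, w.getVert (k + 1)) := by
  induction w with
  | nil => simp
  | cons h q ih =>
    rw [SimpleGraph.Walk.edges_cons, List.mem_cons, ih]
    constructor
    · rintro (rfl | ⟨k, hk, rfl⟩)
      · exact ⟨0, by simp, by simp⟩
      · exact ⟨k + 1, by simpa using hk, by simp⟩
    · rintro ⟨_ | k, hk, rfl⟩
      · left
        simp
      · exact Or.inr ⟨k, by simpa using hk, by simp⟩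

lemma exists_next_dart {x : V} (c : G.Walk x x) {d : G.Dart} (hd : d ∈ c.darts) :
    ∃ d' ∈ c.darts, d'.fst = d.snd := by
  have hfst : d.snd ∈ c.darts.map (·.fst) ∨ d.snd = x := by
    have : d.snd ∈ c.darts.map (·.fst) ++ [x] := by
      rw [SimpleGraph.Walk.map_fst_darts_append]
      exact c.dart_snd_mem_support_of_mem_darts hd
    simpa using this
  rcases hfst with h | h
  · obtain ⟨d', hd', he⟩ := List.mem_map.1 h
    exact ⟨d', hd', he⟩
  -- At the base point the closed walk continues with its first dart.
  · cases c with
    | nil => simp at hd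
    | cons h' q => exact ⟨_, List.mem_cons_self, h.symm⟩

lemma exists_adjacent_dart {x : V} (c : G.Walk x x) {d : G.Dart} (hd : d ∈ c.darts) (b : Bool) :
    ∃ d' ∈ c.darts, dartEnd (!b) d' = dartEnd b d := by
  cases b
  · obtain ⟨d', hd', h⟩ := exists_next_dart c.reverse (d := d.symm)
      (by rw [SimpleGraph.Walk.mem_darts_reverse]; simpa using hd)
    exact ⟨d'.symm, SimpleGraph.Walk.mem_darts_reverse.1 hd', h⟩
  · exact exists_next_dart c hd

open Classical in
/-- The arrows drawn on the paths, as directions along the paths. -/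
noncomputable def position {p : ℕ} (P : Fin p → G.Walk u v) (A : Set G.Dart) (i : Fin p) (k : ℕ) :
    Option Bool :=
  if ∃ hk : k < (P i).length, pathDart (P i) hk true ∈ A then some true
  else if ∃ hk : k < (P i).length, pathDart (P i) hk false ∈ A then some false
  else none

variable {p : ℕ} {P : Fin p → G.Walk u v} {A : Set G.Dart}

lemma position_eq_some_iff (hA : Consistent A) {i : Fin p} {k : ℕ} (hk : k < (P i).length)
    (b : Bool) : position P A i k = some b ↔ pathDart (P i) hk b ∈ A := by
  have h : pathDart (P i) hk true ∈ A → pathDart (P i) hk false ∉ A := by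
    intro h
    have := hA _ h
    rwa [pathDart_symm] at this
  unfold position
  by_cases h1 : pathDart (P i) hk true ∈ A
  · have := h h1
    cases b <;> simp_all
  · by_cases h2 : pathDart (P i) hk false ∈ A <;> cases b <;> simp_all

lemma position_eq_none_iff (hA : Consistent A) {i : Fin p} {k : ℕ} (hk : k < (P i).length) :
    position P A i k = none ↔ ∀ b, pathDart (P i) hk b ∉ A := by
  simp_rw [← position_eq_some_iff hA, Option.eq_none_iff_forall_not_mem, Option.mem_def]

lemma position_of_length_le {i : Fin p} {k : ℕ} (hk : (P i).length ≤ k) :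
    position P A i k = none := by
  have : ¬ k < (P i).length := by omega
  simp [position, this]

lemma position_empty (i : Fin p) (k : ℕ) : position P ∅ i k = none := by
  simp [position]

lemma Consistent.insert {d : G.Dart} (hA : Consistent A) (hd : d.symm ∉ A) :
    Consistent (insert d A) := by
  rintro e (rfl | he) (h | h)
  · exact e.symm_ne h
  · exact hd h
  · refine hd ?_
    rwa [← h, SimpleGraph.Dart.symm_symm]
  · exact hA e he h

/-! ### Translation between the board and the path positions. -/

namespace IsPathsBoard

variable (hG : IsPathsBoard G u v P)

include hG

lemma length_pos (i : Fin p) : 0 < (P i).length := by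
  by_contra h
  exact hG.ne (SimpleGraph.Walk.eq_of_length_eq_zero (p := P i) (by omega))

lemma getVert_eq {i j : Fin p} {k l : ℕ} (hk : k ≤ (P i).length) (hl : l ≤ (P j).length)
    (h : (P i).getVert k = (P j).getVert l) :
    (i = j ∧ k = l) ∨ (k = 0 ∧ l = 0) ∨ (k = (P i).length ∧ l = (P j).length) := by
  by_cases hij : i = j
  · subst hij
    exact Or.inl ⟨rfl, (hG.isPath i).getVert_injOn hk hl h⟩
  · right
    rcases hG.vertex_disjoint i j hij _ ((P i).getVert_mem_support k)
      (h ▸ (P j).getVert_mem_support l) with h1 | h1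
    · exact Or.inl ⟨((hG.isPath i).getVert_eq_start_iff hk).1 h1,
        ((hG.isPath j).getVert_eq_start_iff hl).1 (h ▸ h1)⟩
    · exact Or.inr ⟨((hG.isPath i).getVert_eq_end_iff hk).1 h1,
        ((hG.isPath j).getVert_eq_end_iff hl).1 (h ▸ h1)⟩

lemma exists_pathDart (d : G.Dart) :
    ∃ (i : Fin p) (k : ℕ) (hk : k < (P i).length) (b : Bool), d = pathDart (P i) hk b := by
  obtain ⟨i, hi⟩ := hG.edge_cover d.edge d.edge_mem
  obtain ⟨k, hk, h⟩ := (mem_edges_iff_exists_getVert _ _).1 hi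
  rw [← pathDart_edge (P i) hk true, SimpleGraph.dart_edge_eq_iff, pathDart_symm] at h
  rcases h with h | h
  · exact ⟨i, k, hk, true, h⟩
  · exact ⟨i, k, hk, false, h⟩

lemma edge_inj {i j : Fin p} {k l : ℕ} (hk : k < (P i).length) (hl : l < (P j).length)
    (h : s((P i).getVert k, (P i).getVert (k + 1)) = s((P j).getVert l, (P j).getVert (l + 1))) :
    i = j ∧ k = l := by
  have hij : i = j := by
    by_contra hij
    exact hG.edge_disjoint i j hij _ ((mem_edges_iff_exists_getVert _ _).2 ⟨k, hk, rfl⟩)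
      ((mem_edges_iff_exists_getVert _ _).2 ⟨l, hl, h⟩)
  subst hij
  refine ⟨rfl, ?_⟩
  have inj := fun a b (ha : a ≤ (P i).length) (hb : b ≤ (P i).length) h =>
    (hG.isPath i).getVert_injOn (x₁ := a) (x₂ := b) ha hb h
  rcases Sym2.eq_iff.1 h with ⟨h1, -⟩ | ⟨h1, h2⟩
  · exact inj _ _ hk.le hl.le h1
  · have := inj _ _ hk.le hl h1
    have := inj _ _ hk hl.le h2
    omega

lemma pathDart_inj {i j : Fin p} {k l : ℕ} (hk : k < (P i).length) (hl : l < (P j).length)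
    {b c : Bool} (h : pathDart (P i) hk b = pathDart (P j) hl c) : i = j ∧ k = l ∧ b = c := by
  have he := congrArg SimpleGraph.Dart.edge h
  rw [pathDart_edge, pathDart_edge] at he
  obtain ⟨rfl, rfl⟩ := hG.edge_inj hk hl he
  refine ⟨rfl, rfl, ?_⟩
  by_contra hbc
  have hc : c = !b := by cases b <;> cases c <;> simp_all
  rw [hc, ← pathDart_symm] at h
  exact (pathDart (P i) hk b).symm_ne h.symm

lemma position_insert (hA : Consistent A) {i : Fin p} {k : ℕ} (hk : k < (P i).length) {b : Bool}
    (hs : position P A i k = none) :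
    Consistent (insert (pathDart (P i) hk b) A) ∧
      position P (insert (pathDart (P i) hk b) A) = draw (position P A) i k b := by
  have hn := (position_eq_none_iff hA hk).1 hs
  have hA' : Consistent (insert (pathDart (P i) hk b) A) :=
    hA.insert (by rw [pathDart_symm]; exact hn _)
  refine ⟨hA', ?_⟩
  funext j l
  by_cases hl : l < (P j).length
  · refine Option.ext fun x => ?_
    rw [position_eq_some_iff hA' hl, Set.mem_insert_iff, ← position_eq_some_iff hA hl]
    by_cases h : j = i ∧ l = k
    · obtain ⟨rfl, rfl⟩ := h
      rw [draw_same, Function.update_self, hs]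
      constructor
      · rintro (h | h)
        · rw [(hG.pathDart_inj hl hl h).2.2]
        · cases h
      · rintro ⟨⟩
        exact Or.inl rfl
    · have : draw (position P A) i k b j l = position P A j l := by
        by_cases hj : j = i
        · subst hj
          rw [draw_same, Function.update_of_ne (fun hlk => h ⟨rfl, hlk⟩)]
        · rw [draw_of_ne _ _ hj]
      rw [this]
      refine or_iff_right fun h' => h ?_
      have := hG.pathDart_inj hl hk h'
      exact ⟨this.1, this.2.1⟩
  · rw [position_of_length_le (by omega)]
    by_cases hj : j = i
    · subst hj
      rw [draw_same, Function.update_of_ne (by rintro rfl; exact hl hk),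
        position_of_length_le (by omega)]
    · rw [draw_of_ne _ _ hj, position_of_length_le (by omega)]

/-- The darts that meet an inner vertex of a path. -/
lemma pathDart_of_dartEnd_inner {i j : Fin p} {k l : ℕ} (hk : k + 1 < (P i).length)
    (hl : l < (P j).length) {b c : Bool}
    (h : dartEnd c (pathDart (P j) hl b) = (P i).getVert (k + 1)) :
    j = i ∧ ((b = c ∧ l = k) ∨ (b = (!c) ∧ l = k + 1)) := by
  rw [dartEnd_pathDart] at h
  rcases hG.getVert_eq (by split_ifs <;> omega) hk.le h with ⟨rfl, h1⟩ | h1 | h1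
  · refine ⟨rfl, ?_⟩
    cases b <;> cases c <;> simp_all
  · omega
  · omega

lemma pathDart_of_dartEnd_start {j : Fin p} {l : ℕ} (hl : l < (P j).length) {b c : Bool}
    (h : dartEnd c (pathDart (P j) hl b) = u) : b = (!c) ∧ l = 0 := by
  rw [dartEnd_pathDart, (hG.isPath j).getVert_eq_start_iff (by split_ifs <;> omega)] at h
  cases b <;> cases c <;> simp_all

lemma pathDart_of_dartEnd_finish {j : Fin p} {l : ℕ} (hl : l < (P j).length) {b c : Bool}
    (h : dartEnd c (pathDart (P j) hl b) = v) : b = c ∧ l = (P j).length - 1 := by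
  rw [dartEnd_pathDart, (hG.isPath j).getVert_eq_end_iff (by split_ifs <;> omega)] at h
  split_ifs at h with hbc
  · exact ⟨hbc, by omega⟩
  · omega

/-- An inner vertex meets just two edges, `u` the first edges and `v` the last edges of all paths; a
Boolean selecting head or tail treats sinks and sources together. -/
lemma admissible_iff [NeZero p] (hA : Consistent A) :
    Admissible (fun i => (P i).length) (position P A) ↔
      ∀ x, ¬ IsSink G A x ∧ ¬ IsSource G A x := by
  simp_rw [no_sink_no_source_iff]
  constructor
  · rintro h x c ⟨-, hx⟩
    obtain ⟨i, hi⟩ := hG.vertex_cover x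
    obtain ⟨k, rfl, hk⟩ := SimpleGraph.Walk.mem_support_iff_exists_getVert.1 hi
    rcases Nat.eq_zero_or_pos k with rfl | hk0
    · obtain ⟨j, hj⟩ := h.start (!c)
      refine hj ((position_eq_some_iff hA (hG.length_pos j) _).2 (hx _ ?_))
      rw [dartEnd_pathDart]
      cases c <;> simp
    · rcases hk.eq_or_lt with rfl | hk
      · obtain ⟨j, hj⟩ := h.finish c
        have := hG.length_pos j
        refine hj ((position_eq_some_iff hA (by omega) _).2 (hx _ ?_))
        rw [dartEnd_pathDart, if_pos rfl, Nat.sub_add_cancel this]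
        simp
      · obtain ⟨k, rfl⟩ : ∃ l, k = l + 1 := ⟨k - 1, by omega⟩
        refine h.compatible i k c hk ((position_eq_some_iff hA (by omega) _).2 (hx _ ?_))
          ((position_eq_some_iff hA hk _).2 (hx _ ?_))
        · rw [dartEnd_pathDart, if_pos rfl]
        · rw [dartEnd_pathDart, if_neg (by simp)]
  · intro h
    refine ⟨fun i k b hk h1 h2 => ?_, fun b => ?_, fun b => ?_⟩
    · rw [position_eq_some_iff hA (by omega)] at h1
      rw [position_eq_some_iff hA hk] at h2
      refine h ((P i).getVert (k + 1)) b ⟨⟨_, (P i).adj_getVert_succ hk⟩, fun d hd => ?_⟩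
      obtain ⟨j, l, hl, x, rfl⟩ := hG.exists_pathDart d
      obtain ⟨rfl, ⟨rfl, rfl⟩ | ⟨rfl, rfl⟩⟩ := hG.pathDart_of_dartEnd_inner hk hl hd
      · exact h1
      · exact h2
    · by_contra hcon
      push Not at hcon
      refine h u (!b) ⟨⟨(P 0).getVert 1, ?_⟩, fun d hd => ?_⟩
      · simpa using (P 0).adj_getVert_succ (hG.length_pos 0)
      · obtain ⟨j, l, hl, x, rfl⟩ := hG.exists_pathDart d
        obtain ⟨rfl, rfl⟩ := hG.pathDart_of_dartEnd_start hl hd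
        rw [Bool.not_not, ← position_eq_some_iff hA]
        exact hcon j
    · by_contra hcon
      push Not at hcon
      refine h v b ⟨⟨(P 0).getVert ((P 0).length - 1), ?_⟩, fun d hd => ?_⟩
      · have h0 := hG.length_pos 0
        have := (P 0).adj_getVert_succ (i := (P 0).length - 1) (by omega)
        rw [Nat.sub_add_cancel h0, SimpleGraph.Walk.getVert_length] at this
        exact this.symm
      · obtain ⟨j, l, hl, x, rfl⟩ := hG.exists_pathDart d
        obtain ⟨rfl, rfl⟩ := hG.pathDart_of_dartEnd_finish hl hd
        rw [← position_eq_some_iff hA]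
        exact hcon j

lemma legal_iff [NeZero p] (hA : Consistent A) {i : Fin p} {k : ℕ} (hk : k < (P i).length)
    {b : Bool} :
    Legal G A (pathDart (P i) hk b) ↔ position P A i k = none ∧
      Admissible (fun i => (P i).length) (draw (position P A) i k b) := by
  have hnone : position P A i k = none ↔
      pathDart (P i) hk b ∉ A ∧ (pathDart (P i) hk b).symm ∉ A := by
    rw [position_eq_none_iff hA hk, pathDart_symm, Bool.forall_bool]
    cases b
    · rfl
    · exact and_comm
  rw [Legal, ← and_assoc, ← hnone]
  refine and_congr_right fun h => ?_
  obtain ⟨h1, h2⟩ := hG.position_insert (b := b) hA hk h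
  rw [← h2, hG.admissible_iff h1]

/-! ### Directed cycles on the board. -/

/-- A directed cycle that contains an arrow on a path runs along the whole path. -/
lemma full_of_mem_darts (hA : Consistent A) {x : V} {c : G.Walk x x} (hc : ∀ d ∈ c.darts, d ∈ A)
    {i : Fin p} {k : ℕ} (hk : k < (P i).length) {b : Bool} (hd : pathDart (P i) hk b ∈ c.darts)
    {l : ℕ} (hl : l < (P i).length) : pathDart (P i) hl b ∈ c.darts := by
  have hsymm : ∀ {m} (hm : m < (P i).length), pathDart (P i) hm b ∈ c.darts →
      pathDart (P i) hm (!b) ∉ c.darts := by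
    intro m hm h1 h2
    rw [← pathDart_symm] at h2
    exact hA _ (hc _ h1) (hc _ h2)
  -- At an inner vertex the cycle must continue along the only other edge, since `Consistent` rules
  -- out turning back.
  have hstep : ∀ {m} (hm : m + 1 < (P i).length),
      pathDart (P i) ((Nat.lt_succ_self m).trans hm) b ∈ c.darts ↔
        pathDart (P i) hm b ∈ c.darts := by
    intro m hm
    constructor
    · intro h
      obtain ⟨d, hmem, he⟩ := exists_adjacent_dart c h b
      rw [dartEnd_pathDart, if_pos rfl] at he
      obtain ⟨j, l, hl, y, rfl⟩ := hG.exists_pathDart d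
      obtain ⟨rfl, ⟨rfl, rfl⟩ | ⟨rfl, rfl⟩⟩ := hG.pathDart_of_dartEnd_inner hm hl he
      · exact absurd hmem (hsymm _ h)
      · rwa [Bool.not_not] at hmem
    · intro h
      obtain ⟨d, hmem, he⟩ := exists_adjacent_dart c h (!b)
      rw [dartEnd_pathDart, if_neg (by simp), Bool.not_not] at he
      obtain ⟨j, l, hl, y, rfl⟩ := hG.exists_pathDart d
      obtain ⟨rfl, ⟨rfl, rfl⟩ | ⟨rfl, rfl⟩⟩ := hG.pathDart_of_dartEnd_inner hm hl he
      · exact hmem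
      · exact absurd hmem (hsymm _ h)
  have hfirst : ∀ {m} (hm : m < (P i).length),
      pathDart (P i) hm b ∈ c.darts ↔ pathDart (P i) (hG.length_pos i) b ∈ c.darts := by
    intro m
    induction m with
    | zero => exact fun _ => Iff.rfl
    | succ m ih => exact fun hm => (hstep hm).symm.trans (ih _)
  exact (hfirst hl).2 ((hfirst hk).1 hd)

/-- A directed cycle runs along two paths in opposite directions. -/
lemma exists_full_path (hA : Consistent A) {x : V} {c : G.Walk x x} (hcyc : c.IsCycle)
    (hc : ∀ d ∈ c.darts, d ∈ A) (b : Bool) :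
    ∃ i, ∀ k, ∀ hk : k < (P i).length, pathDart (P i) hk b ∈ c.darts := by
  suffices h : ∃ i k, ∃ hk : k < (P i).length, pathDart (P i) hk b ∈ c.darts by
    obtain ⟨i, k, hk, h⟩ := h
    exact ⟨i, fun l hl => hG.full_of_mem_darts hA hc hk h hl⟩
  have h3 := hcyc.three_le_length
  obtain ⟨i, k, hk, y, hd⟩ := hG.exists_pathDart (c.darts[0]'(by simp; omega))
  have hmem := List.getElem_mem (l := c.darts) (n := 0) (by simp; omega)
  rw [hd] at hmem
  by_cases hy : y = b
  · exact ⟨i, k, hk, hy ▸ hmem⟩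
  · have hy : y = !b := by cases b <;> cases y <;> simp_all
    subst hy
    have h0 := hG.length_pos i
    have hlast := hG.full_of_mem_darts hA hc hk hmem (l := (P i).length - 1) (by omega)
    -- A cycle using a path in direction `!b` reaches its end at `v`; the adjacent dart there runs
    -- along its path in direction `b`.
    obtain ⟨d, hd, he⟩ := exists_adjacent_dart c hlast (!b)
    rw [dartEnd_pathDart, if_pos rfl, Nat.sub_add_cancel h0, SimpleGraph.Walk.getVert_length] at he
    obtain ⟨j, l, hl, y, rfl⟩ := hG.exists_pathDart d
    obtain ⟨rfl, rfl⟩ := hG.pathDart_of_dartEnd_finish hl he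
    rw [Bool.not_not] at hd
    exact ⟨j, _, hl, hd⟩

/-- In a controlled position no move is the first to complete a cycle cell. -/
lemma hasCycleCell_of_insert (hA : Consistent A)
    (hK : Controlled (fun i => (P i).length) (position P A)) {i : Fin p} {k : ℕ}
    (hk : k < (P i).length) {b : Bool} (hs : position P A i k = none)
    {cells : Set (Set (Sym2 V))}
    (h : HasCycleCell G cells (insert (pathDart (P i) hk b) A)) : HasCycleCell G cells A := by
  obtain ⟨x, c, hcyc, hcell, hc⟩ := h
  obtain ⟨hA', hpos⟩ := hG.position_insert (b := b) hA hk hs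
  rcases hK.shape with hbal | ⟨y, hy⟩
  · by_cases hd : pathDart (P i) hk b ∈ c.darts
    -- The cycle would fill the whole path, so this path had exactly one open edge before the move.
    · exfalso
      refine (hbal i).openCount_ne_one ?_
      rw [← openCount_update (b := b) hk hs, ← draw_same, ← hpos, openCount_eq_zero_of_full]
      intro l hl
      rw [(position_eq_some_iff hA' hl b).2 (hc _ (hG.full_of_mem_darts hA' hc hk hd hl))]
      simp
    · refine ⟨x, c, hcyc, hcell, fun d hdc => (hc d hdc).resolve_left ?_⟩
      rintro rfl
      exact hd hdc
  · exfalso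
    obtain ⟨j, hj⟩ := hG.exists_full_path hA' hcyc hc (!y)
    obtain ⟨l, hl, hjl⟩ := (hy.draw (x := b) hs).exists_arrow j
    rw [← hpos, (position_eq_some_iff hA' hl (!y)).2 (hc _ (hj l hl))] at hjl
    simp at hjl

lemma sum_length : ∑ i, (P i).length = G.edgeSet.ncard := by
  let f : (Σ i : Fin p, Fin (P i).length) → Sym2 V :=
    fun a => s((P a.1).getVert a.2, (P a.1).getVert (a.2 + 1))
  have hf : Function.Injective f := by
    rintro ⟨i, k, hk⟩ ⟨j, l, hl⟩ h
    obtain ⟨rfl, rfl⟩ := hG.edge_inj hk hl h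
    rfl
  have hr : Set.range f = G.edgeSet := by
    ext e
    constructor
    · rintro ⟨⟨i, k, hk⟩, rfl⟩
      exact (P i).adj_getVert_succ hk
    · intro he
      obtain ⟨i, hi⟩ := hG.edge_cover e he
      obtain ⟨k, hk, rfl⟩ := (mem_edges_iff_exists_getVert _ _).1 hi
      exact ⟨⟨i, k, hk⟩, rfl⟩
  rw [← hr, ← Nat.card_coe_set_eq, Nat.card_congr (Equiv.ofInjective f hf).symm]
  simp

end IsPathsBoard

/-! ### From the invariant to a winning strategy. -/

/-- A strategy wins if its moves lead to a class of positions from which each legal move can be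
answered within the class, and in which no legal move is the first to complete a cycle cell. -/
lemma exists_winning_strategy {cells : Set (Set (Sym2 V))} (K : Set G.Dart → Prop) (d₀ : G.Dart)
    (h₀ : Legal G ∅ d₀) (hK₀ : K (insert d₀ ∅))
    (hcell : ∀ B d, K B → Legal G B d → HasCycleCell G cells (insert d B) →
      HasCycleCell G cells B)
    (hreply : ∀ B d, K B → Legal G B d →
      ∃ d', Legal G (insert d B) d' ∧ K (insert d' (insert d B))) :
    ∃ σ : Strategy G, IsWinningForPlayer1 G cells σ ∧ σ ∅ = d₀ := by
  classical
  let σ : Strategy G := fun A =>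
    -- The empty position occurs only at the start, so prescribing the opening there does not
    -- interfere with later replies.
    if A = ∅ then d₀ else
      if h : ∃ d, Legal G A d ∧ K (insert d A) then h.choose else d₀
  have hσ : ∀ A, Reached G cells σ A → Legal G A (σ A) ∧ K (insert (σ A) A) := by
    intro A hA
    induction hA with
    | start =>
      have : σ ∅ = d₀ := if_pos rfl
      rw [this]
      exact ⟨h₀, hK₀⟩
    | round A d _ _ _ hd _ ih =>
      have h := hreply _ d ih.2 hd
      have hσ' : σ (insert d (insert (σ A) A)) = h.choose := by
        simp only [σ]
        rw [if_neg (Set.insert_nonempty _ _).ne_empty, dif_pos]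
      rw [hσ']
      exact h.choose_spec
  refine ⟨σ, fun A hA => ⟨(hσ A hA).1, ?_⟩, by simp [σ]⟩
  by_cases h : HasCycleCell G cells (insert (σ A) A)
  · exact Or.inl h
  · exact Or.inr fun d hd hcc => h (hcell _ d (hσ A hA).2 hd hcc)

/-- Player 1 wins by opening with the central edge of a path of odd length, if all other paths of
odd length have at least five edges. -/
theorem IsPathsBoard.exists_winning_strategy_center (hG : IsPathsBoard G u v P) (hp : 2 ≤ p)
    (hodd : Odd G.edgeSet.ncard) (cells : Set (Set (Sym2 V))) {i : Fin p}
    (hi : Odd (P i).length) (hlong : ∀ j, j ≠ i → Odd (P j).length → 5 ≤ (P j).length)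
    (d : G.Dart) (hd : d.edge = centralEdge (P i)) :
    ∃ σ : Strategy G, IsWinningForPlayer1 G cells σ ∧ σ ∅ = d := by
  have : NeZero p := ⟨by omega⟩
  have : Nontrivial (Fin p) := Fin.nontrivial_iff_two_le.2 hp
  have hlen := hG.length_pos i
  have hmid : (P i).length / 2 < (P i).length := by omega
  obtain ⟨b, rfl⟩ : ∃ b, d = pathDart (P i) hmid b := by
    rw [centralEdge, ← pathDart_edge (P i) hmid true, SimpleGraph.dart_edge_eq_iff,
      pathDart_symm] at hd
    rcases hd with hd | hd
    · exact ⟨true, hd⟩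
    · exact ⟨false, hd⟩
  have hempty : Consistent (∅ : Set G.Dart) := fun d hd => absurd hd (Set.notMem_empty d)
  have hstart := controlled_draw_center (n := fun i => (P i).length) (s := position P ∅)
    position_empty (by simpa [openCount, position_empty, hG.sum_length] using hodd) hi hlong b
  obtain ⟨h1, h2⟩ := hG.position_insert (b := b) hempty hmid (position_empty i _)
  refine exists_winning_strategy
    (fun B => Consistent B ∧ Controlled (fun i => (P i).length) (position P B)) _
    ((hG.legal_iff hempty hmid).2 ⟨position_empty _ _, hstart.admissible⟩)
    ⟨h1, h2 ▸ hstart⟩ ?_ ?_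
  · rintro B d ⟨hB, hK⟩ hd hcc
    obtain ⟨j, k, hk, x, rfl⟩ := hG.exists_pathDart d
    exact hG.hasCycleCell_of_insert hB hK hk ((hG.legal_iff hB hk).1 hd).1 hcc
  · rintro B d ⟨hB, hK⟩ hd
    obtain ⟨j, k, hk, x, rfl⟩ := hG.exists_pathDart d
    obtain ⟨hs, ha⟩ := (hG.legal_iff hB hk).1 hd
    obtain ⟨h3, h4⟩ := hG.position_insert (b := x) hB hk hs
    obtain ⟨j', k', x', hk', hs', hK'⟩ := hK.exists_reply hG.length_pos hk hs ha
    rw [← h4] at hs' hK'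
    obtain ⟨h5, h6⟩ := hG.position_insert (b := x') h3 hk' hs'
    exact ⟨pathDart (P j') hk' x', (hG.legal_iff h3 hk').2 ⟨hs', hK'.admissible⟩, h5,
      h6 ▸ hK'⟩

end Board

end GameOfCycles

theorem mainTheorem8 {V : Type*} (G : SimpleGraph V) (u v : V) (p : ℕ) (hp : 2 ≤ p)
    (P : Fin p → G.Walk u v) (hG : GameOfCycles.IsPathsBoard G u v P)
    (hodd : Odd G.edgeSet.ncard)
    (hshort : ∀ i j, Odd (P i).length → (P i).length < 5 →
      Odd (P j).length → (P j).length < 5 → i = j)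
    (cells : Set (Set (Sym2 V)))
    (hcells : cells = GameOfCycles.chordlessCycles G ∨
      ∃ τ : Equiv.Perm (Fin p), cells = GameOfCycles.boundedFaces P τ) :
    (∃ σ : GameOfCycles.Strategy G, GameOfCycles.IsWinningForPlayer1 G cells σ) ∧
    ∀ i, (P i).length = 3 ∨ (P i).length = 1 →
      ∀ d : G.Dart, d.edge = GameOfCycles.centralEdge (P i) →
        ∃ σ : GameOfCycles.Strategy G,
          GameOfCycles.IsWinningForPlayer1 G cells σ ∧ σ ∅ = d := by
  have hshort' : ∀ i, Odd (P i).length → (P i).length < 5 →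
      ∀ j, j ≠ i → Odd (P j).length → 5 ≤ (P j).length := by
    intro i hi hi5 j hji hj
    by_contra hj5
    exact hji (hshort j i hj (by omega) hi hi5)
  constructor
  · obtain ⟨i, hi, hlong⟩ : ∃ i, Odd (P i).length ∧
        ∀ j, j ≠ i → Odd (P j).length → 5 ≤ (P j).length := by
      -- The opening is on the short odd path if there is one, otherwise on any odd path, which
      -- exists because the total is odd.
      by_cases h : ∃ i, Odd (P i).length ∧ (P i).length < 5
      · obtain ⟨i, hi, hi5⟩ := h
        exact ⟨i, hi, hshort' i hi hi5⟩
      · push Not at h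
        obtain ⟨i, hi⟩ : ∃ i, Odd (P i).length := by
          by_contra hcon
          push Not at hcon
          rw [← hG.sum_length, ← Nat.not_even_iff_odd] at hodd
          exact hodd (Finset.even_sum _ fun i _ => Nat.not_odd_iff_even.1 (hcon i))
        exact ⟨i, hi, fun j _ hj => h j hj⟩
    have hmid : (P i).length / 2 < (P i).length := Nat.div_lt_self hi.pos (by decide)
    obtain ⟨σ, hσ, -⟩ := hG.exists_winning_strategy_center hp hodd cells hi hlong
      (GameOfCycles.pathDart (P i) hmid true) (GameOfCycles.pathDart_edge _ _ _)
    exact ⟨σ, hσ⟩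
  · intro i hi d hd
    have hio : Odd (P i).length := by
      rcases hi with hi | hi <;> rw [hi] <;> decide
    exact hG.exists_winning_strategy_center hp hodd cells hio (hshort' i hio (by omega)) d hd
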